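/- Let $\gamma\colon[0,1]\to\mathbb{R}^2$ be a simple loop, i.e. a continuous map with $\gamma(0)=\gamma(1)$ that is injective except for this coincidence of the two endpoints. Say that $\gamma$ inscribes a rectangle if all four vertices of the rectangle lie in $\gamma([0,1])$. Then the set of all vertices of non-degenerate rectangles (both side lengths positive) inscribed in $\gamma$ is dense in $\gamma([0,1])$. -/

import Mathlib

/-- The Euclidean plane. -/
abbrev Plane : Type := EuclideanSpace ℝ (Fin 2)

/-- A simple loop: a continuous closed curve, parametrized by the unit interval `[0, 1]`, whose only
coincidence of values at distinct parameters is that of its two endpoints. -/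
structure IsSimpleLoop (γ : unitInterval → Plane) : Prop where
  continuous : Continuous γ
  closed : γ 0 = γ 1
  simple : ∀ s t : unitInterval, s < t → γ s = γ t → s = 0 ∧ t = 1

/-- `A B C D` are, in cyclic order, the vertices of a non-degenerate rectangle: they form a
parallelogram with a right angle at `A`, and the two sides meeting at `A` have positive length. -/
structure IsNondegenerateRectangle (A B C D : Plane) : Prop where
  parallelogram : B - A = C - D
  rightAngle : inner ℝ (B - A) (D - A) = 0
  side_ne : A ≠ B
  side_ne' : A ≠ D

/-- A curve inscribes the rectangle `A B C D` if that rectangle is non-degenerate and the curve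
contains its four vertices. -/
def InscribesRectangle (γ : unitInterval → Plane) (A B C D : Plane) : Prop :=
  IsNondegenerateRectangle A B C D ∧
    A ∈ Set.range γ ∧ B ∈ Set.range γ ∧ C ∈ Set.range γ ∧ D ∈ Set.range γ

/-- The set of all vertices of non-degenerate rectangles inscribed in the curve. -/
def inscribedRectangleVertices (γ : unitInterval → Plane) : Set Plane :=
  {P | ∃ A B C D : Plane, InscribesRectangle γ A B C D ∧ (P = A ∨ P = B ∨ P = C ∨ P = D)}

/-!
Vaughan's argument: send the chord with ends `u`, `v` on the curve to its midpoint and its squared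
length. Two chords with the same image are the diagonals of a rectangle, so a curve without
inscribed rectangles would embed the Möbius strip of chords in a closed half-space of `ℝ³`, with
exactly the boundary of the strip on the bounding plane, which is impossible. For density, the
impossibility is shown using only chords near one loop.

Suppose that no rectangle has a vertex on a given arc of the curve. Move one end of a chord slightly
within the arc and the other once around the curve, so that the two ends are exchanged. This is a
one-sided loop in the Möbius strip, and by hypothesis each of its chords is the only chord with its
image (`chordMap_injOn`). Compare the chords `x` of the loop with all chords `y`: the difference of
the images vanishes only for `x = y`. Remove a neighbourhood of this locus, and move `x` and `y`
apart symmetrically close to it, so that the difference becomes odd on the inner boundary. The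
difference then is a nowhere zero map to `ℝ³` on a three-dimensional space. On the outer boundary,
`y` is degenerate, so the difference of the squared lengths is positive; the rest is glued to
itself. Hence its degree on the inner boundary is even. But the inner boundary is a Klein bottle,
and since the loop is one-sided, an odd map on it has odd degree. This contradiction is
`exists_zero_of_equivariant`.

The parity of the degree is computed as in Tucker's lemma. On a fine grid each value is replaced by
the nearest half-axis of `ℝ³`, and the degree is the number of triangles labelled by the positive
first, negative second and positive third half-axes. That the degree vanishes on boundaries is
`SignedAxis.sum_faces_box`, and the count on the inner boundary, by descent to edges and vertices,
is in `SignedAxis.not_exists_labels`.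
-/

/-! ### Signed coordinate axes and the alternating cochains -/

/-- A signed coordinate axis of `ℝ³`, that is, a vertex of the octahedron: `(i, true)` is the
positive and `(i, false)` the negative half of the `i`-th axis. -/
abbrev SignedAxis : Type := Fin 3 × Bool

namespace SignedAxis

/-- The opposite half-axis. -/
def neg (a : SignedAxis) : SignedAxis := (a.1, !a.2)

/-- Two half-axes are compatible if they are not opposite, that is, if they span a simplex of the
octahedral sphere. -/
def Compat (a b : SignedAxis) : Prop := a.1 = b.1 → a.2 = b.2

instance : DecidableRel Compat := fun a b => inferInstanceAs (Decidable (a.1 = b.1 → a.2 = b.2))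

/-- The indicator of the positive half-axes. The cochains `c₀`, `c₁`, `c₂` on the octahedral sphere
indicate the simplices whose signs, read in the order of the axes, are `+`, `+-` and `+-+`. With `δ`
the coboundary and `ν` the pullback under `neg`, they satisfy `c₀ + ν c₀ = 1`, `c₁ + ν c₁ = δ c₀`
and `c₂ + ν c₂ = δ c₁`. -/
def c₀ (a : SignedAxis) : ZMod 2 := if a.2 then 1 else 0

/-- The indicator of the edges with signs `+-` in the order of the axes. -/
def c₁ (a b : SignedAxis) : ZMod 2 :=
  if (a.1 < b.1 ∧ a.2 ∧ !b.2) ∨ (b.1 < a.1 ∧ b.2 ∧ !a.2) then 1 else 0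

/-- The indicator of the triangle with signs `+-+` in the order of the axes. -/
def c₂ (a b c : SignedAxis) : ZMod 2 :=
  if (a = (0, true) ∨ b = (0, true) ∨ c = (0, true)) ∧
    (a = (1, false) ∨ b = (1, false) ∨ c = (1, false)) ∧
    (a = (2, true) ∨ b = (2, true) ∨ c = (2, true)) then 1 else 0

theorem c₀_neg (a : SignedAxis) : c₀ a + c₀ a.neg = 1 := by
  revert a; decide

theorem c₁_comm (a b : SignedAxis) : c₁ a b = c₁ b a := by
  simp only [c₁, or_comm]

theorem c₁_add_neg {a b : SignedAxis} (h : Compat a b) :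
    c₁ a b + c₁ a.neg b.neg = c₀ a + c₀ b := by
  revert a b; decide

theorem c₂_swap_left (a b c : SignedAxis) : c₂ a b c = c₂ b a c := by
  simp only [c₂, or_left_comm]

theorem c₂_swap_right (a b c : SignedAxis) : c₂ a b c = c₂ a c b := by
  simp only [c₂, or_comm]

set_option maxRecDepth 100000 in
theorem c₂_add_neg {a b c : SignedAxis} (hab : Compat a b) (hac : Compat a c) (hbc : Compat b c) :
    c₂ a b c + c₂ a.neg b.neg c.neg = c₁ b c + c₁ a c + c₁ a b := by
  revert a b c; decide

set_option maxRecDepth 100000 in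
/-- The octahedral sphere has no simplices of dimension 3, so every 2-cochain on it is a cocycle. -/
theorem c₂_cocycle {a b c d : SignedAxis} (hab : Compat a b) (hac : Compat a c) (had : Compat a d)
    (hbc : Compat b c) (hbd : Compat b d) (hcd : Compat c d) :
    c₂ b c d + c₂ a c d + c₂ a b d + c₂ a b c = 0 := by
  revert a b c d; decide

theorem c₂_eq_zero {a b c : SignedAxis} (ha : a ≠ (1, false)) (hb : b ≠ (1, false))
    (hc : c ≠ (1, false)) : c₂ a b c = 0 := by
  simp [c₂, ha, hb, hc]

/-- The value of `c₂` on a square with vertices `a, b, c, d` (`a` and `d` opposite), cut into two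
triangles along the diagonal from `a` to `d`. -/
def sq (a b c d : SignedAxis) : ZMod 2 := c₂ a b d + c₂ a c d

/-- The other diagonal gives the same value, so `sq` does not see a reflection of the square. -/
theorem sq_flip {a b c d : SignedAxis} (hab : Compat a b) (hac : Compat a c) (had : Compat a d)
    (hbc : Compat b c) (hbd : Compat b d) (hcd : Compat c d) : sq b a d c = sq a b c d := by
  have h := c₂_cocycle hab hac had hbc hbd hcd
  have e₁ : c₂ b a c = c₂ a b c := c₂_swap_left ..
  have e₂ : c₂ b d c = c₂ b c d := c₂_swap_right ..
  have two : (2 : ZMod 2) = 0 := by decide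
  unfold sq
  rw [e₁, e₂]
  linear_combination h - (c₂ a b d + c₂ a c d) * two

theorem sq_add_neg {a b c d : SignedAxis} (hab : Compat a b) (hac : Compat a c) (had : Compat a d)
    (hbd : Compat b d) (hcd : Compat c d) :
    sq a b c d + sq a.neg b.neg c.neg d.neg = c₁ a b + c₁ c d + c₁ a c + c₁ b d := by
  have two : (2 : ZMod 2) = 0 := by decide
  unfold sq
  linear_combination c₂_add_neg hab had hbd + c₂_add_neg hac had hcd + c₁ a d * two

open Finset

/-! ### Labelled boxes -/

theorem sum_range_add_succ (φ : ℕ → ZMod 2) (n : ℕ) :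
    ∑ i ∈ range n, (φ i + φ (i + 1)) = φ 0 + φ n := by
  have two : (2 : ZMod 2) = 0 := by decide
  induction n with
  | zero => simp only [range_zero, sum_empty]; linear_combination (-φ 0) * two
  | succ n ih => rw [sum_range_succ, ih]; linear_combination φ n * two

/-- The cube is the union of six tetrahedra around the diagonal from `o` to `w`. -/
theorem sum_sq_cube {o x y z xy xz yz w : SignedAxis}
    (h : ([o, x, y, z, xy, xz, yz, w] : List SignedAxis).Pairwise Compat) :
    (sq o x y xy + sq z xz yz w) + (sq o x z xz + sq y xy yz w) + (sq o y z yz + sq x xy xz w)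
      = 0 := by
  have two : (2 : ZMod 2) = 0 := by decide
  simp only [List.pairwise_cons, List.mem_cons, List.not_mem_nil, or_false, forall_eq_or_imp,
    forall_eq, List.Pairwise.nil, and_true, IsEmpty.forall_iff, implies_true] at h
  obtain ⟨⟨ox, oy, oz, oxy, oxz, oyz, ow⟩, ⟨_, _, xxy, xxz, _, xw⟩, ⟨_, yxy, _, yyz, yw⟩,
    ⟨_, zxz, zyz, zw⟩, ⟨_, _, xyw⟩, ⟨_, xzw⟩, yzw⟩ := h
  unfold sq
  linear_combination c₂_cocycle ox oxy ow xxy xw xyw + c₂_cocycle ox oxz ow xxz xw xzw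
    + c₂_cocycle oy oxy ow yxy yw xyw + c₂_cocycle oy oyz ow yyz yw yzw
    + c₂_cocycle oz oxz ow zxz zw xzw + c₂_cocycle oz oyz ow zyz zw yzw
    - (c₂ o x w + c₂ o y w + c₂ o z w + c₂ o xy w + c₂ o xz w + c₂ o yz w) * two

/-- The value of `c₂` on the unit square at `(i, j, k)` in the first two directions. -/
def face₁₂ (A : ℕ → ℕ → ℕ → SignedAxis) (i j k : ℕ) : ZMod 2 :=
  sq (A i j k) (A (i + 1) j k) (A i (j + 1) k) (A (i + 1) (j + 1) k)

/-- The value of `c₂` on the unit square at `(i, j, k)` in the first and third directions. -/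
def face₁₃ (A : ℕ → ℕ → ℕ → SignedAxis) (i j k : ℕ) : ZMod 2 :=
  sq (A i j k) (A (i + 1) j k) (A i j (k + 1)) (A (i + 1) j (k + 1))

/-- The value of `c₂` on the unit square at `(i, j, k)` in the last two directions. -/
def face₂₃ (A : ℕ → ℕ → ℕ → SignedAxis) (i j k : ℕ) : ZMod 2 :=
  sq (A i j k) (A i (j + 1) k) (A i j (k + 1)) (A i (j + 1) (k + 1))

/-- Any two points of the box `[0, a] × [0, b] × [0, c]` that lie in a common unit cube have
compatible labels. -/
def CompatOn (A : ℕ → ℕ → ℕ → SignedAxis) (a b c : ℕ) : Prop :=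
  ∀ i i' j j' k k', i ≤ a → i' ≤ a → j ≤ b → j' ≤ b → k ≤ c → k' ≤ c →
    i ≤ i' + 1 → i' ≤ i + 1 → j ≤ j' + 1 → j' ≤ j + 1 → k ≤ k' + 1 → k' ≤ k + 1 →
    Compat (A i j k) (A i' j' k')

/-- Stokes' theorem: `c₂` vanishes on the boundary of a labelled box. -/
theorem sum_faces_box {A : ℕ → ℕ → ℕ → SignedAxis} {a b c : ℕ} (hA : CompatOn A a b c) :
    ∑ i ∈ range a, ∑ j ∈ range b, (face₁₂ A i j 0 + face₁₂ A i j c)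
      + ∑ i ∈ range a, ∑ k ∈ range c, (face₁₃ A i 0 k + face₁₃ A i b k)
      + ∑ j ∈ range b, ∑ k ∈ range c, (face₂₃ A 0 j k + face₂₃ A a j k) = 0 := by
  have cube : ∀ i ∈ range a, ∀ j ∈ range b, ∀ k ∈ range c,
      (face₁₂ A i j k + face₁₂ A i j (k + 1)) + (face₁₃ A i j k + face₁₃ A i (j + 1) k)
        + (face₂₃ A i j k + face₂₃ A (i + 1) j k) = 0 := by
    intro i hi j hj k hk
    rw [mem_range] at hi hj hk
    apply sum_sq_cube
    simp only [List.pairwise_cons, List.mem_cons, List.not_mem_nil, or_false, forall_eq_or_imp,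
      forall_eq, List.Pairwise.nil, and_true, IsEmpty.forall_iff, implies_true]
    refine ⟨⟨?_, ?_, ?_, ?_, ?_, ?_, ?_⟩, ⟨?_, ?_, ?_, ?_, ?_, ?_⟩, ⟨?_, ?_, ?_, ?_, ?_⟩,
      ⟨?_, ?_, ?_, ?_⟩, ⟨?_, ?_, ?_⟩, ⟨?_, ?_⟩, ?_⟩ <;> apply hA <;> omega
  have total := sum_eq_zero fun i hi => sum_eq_zero fun j hj => sum_eq_zero fun k hk =>
    cube i hi j hj k hk
  simp only [sum_add_distrib (f := fun k => (face₁₂ A _ _ k + face₁₂ A _ _ (k + 1))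
    + (face₁₃ A _ _ k + face₁₃ A _ (_ + 1) k)),
    sum_add_distrib (f := fun k => (face₁₂ A _ _ k + face₁₂ A _ _ (k + 1)))] at total
  have e₁ : ∀ i j, ∑ k ∈ range c, (face₁₂ A i j k + face₁₂ A i j (k + 1))
      = face₁₂ A i j 0 + face₁₂ A i j c := fun i j => sum_range_add_succ (face₁₂ A i j) c
  have e₂ : ∀ i, ∑ j ∈ range b, ∑ k ∈ range c, (face₁₃ A i j k + face₁₃ A i (j + 1) k)
      = ∑ k ∈ range c, (face₁₃ A i 0 k + face₁₃ A i b k) := fun i => by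
    rw [sum_comm]
    exact sum_congr rfl fun k _ => sum_range_add_succ (fun j => face₁₃ A i j k) b
  have e₃ : ∑ i ∈ range a, ∑ j ∈ range b, ∑ k ∈ range c, (face₂₃ A i j k + face₂₃ A (i + 1) j k)
      = ∑ j ∈ range b, ∑ k ∈ range c, (face₂₃ A 0 j k + face₂₃ A a j k) := by
    rw [sum_comm]
    refine sum_congr rfl fun j _ => ?_
    rw [sum_comm]
    exact sum_congr rfl fun k _ => sum_range_add_succ (fun i => face₂₃ A i j k) a
  rw [← total, ← e₃, ← sum_add_distrib, ← sum_add_distrib]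
  refine sum_congr rfl fun i _ => ?_
  rw [← e₂, ← sum_add_distrib, ← sum_add_distrib]
  refine sum_congr rfl fun j _ => ?_
  rw [← e₁, ← sum_add_distrib, ← sum_add_distrib]

theorem sum_range_two_mul (φ : ℕ → ZMod 2) (n : ℕ) :
    ∑ i ∈ range (2 * n), φ i = ∑ i ∈ range n, φ i + ∑ i ∈ range n, φ (n + i) := by
  rw [two_mul, sum_range_add]

/-- The combinatorial form of `exists_zero_of_equivariant`. The first coordinates of the boxes `A`
and `B` run through the two halves of the boundary of a square, from the corner `(1, -1)` to `(-1,
1)` and on to `(1, -1)`, with a corner at `n`; opposite points of the square have the same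
coordinate. All faces of the two boxes except the inner ones (`j = 0`) cancel, whereas on these the
relations between `c₂`, `c₁` and `c₀` reduce the sum to the number of positive labels in an
antipodal pair. -/
theorem not_exists_labels {n : ℕ} {A B : ℕ → ℕ → ℕ → SignedAxis}
    (hA : CompatOn A (2 * n) n n) (hB : CompatOn B (2 * n) n n)
    (endA : ∀ j k, A (2 * n) j k = B 0 j k) (endB : ∀ j k, B (2 * n) j k = A 0 j k)
    (inner : ∀ i k, i ≤ 2 * n → k ≤ n → B i 0 k = (A i 0 k).neg)
    (side : ∀ i k, i ≤ n → B i n k = A i n k)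
    (topA : ∀ i k, n ≤ i → i ≤ 2 * n → k ≤ n → A i n k ≠ (1, false))
    (topB : ∀ i k, n ≤ i → i ≤ 2 * n → k ≤ n → B i n k ≠ (1, false))
    (glueA : ∀ i j, i ≤ n → A i j n = A (n - i) j 0)
    (glueB : ∀ i j, i ≤ n → B i j n = B (n - i) j 0)
    (glueA' : ∀ i j, i ≤ n → A (n + i) j n = B (n + (n - i)) j 0)
    (glueB' : ∀ i j, i ≤ n → B (n + i) j n = A (n + (n - i)) j 0) : False := by
  have two : (2 : ZMod 2) = 0 := by decide
  -- the faces `k = 0` and `k = n` cancel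
  have flip : ∀ {C D : ℕ → ℕ → ℕ → SignedAxis} {s : ℕ}, s ≤ n → CompatOn D (2 * n) n n →
      (∀ i j, i ≤ n → C (s + i) j n = D (s + (n - i)) j 0) →
      ∑ i ∈ range n, ∑ j ∈ range n, face₁₂ C (s + i) j n
        = ∑ i ∈ range n, ∑ j ∈ range n, face₁₂ D (s + i) j 0 := by
    intro C D s hs hD h
    rw [← sum_range_reflect (fun i => ∑ j ∈ range n, face₁₂ D (s + i) j 0)]
    refine sum_congr rfl fun i hi => sum_congr rfl fun j hj => ?_
    rw [mem_range] at hi hj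
    have e : n - i = n - 1 - i + 1 := by omega
    have e' : n - (i + 1) = n - 1 - i := by omega
    unfold face₁₂
    rw [add_assoc s i 1, h i j hi.le, h (i + 1) j hi, h i (j + 1) hi.le, h (i + 1) (j + 1) hi, e, e',
      add_assoc s _ 1]
    apply sq_flip <;> apply hD <;> omega
  have tau : ∑ i ∈ range (2 * n), ∑ j ∈ range n, (face₁₂ A i j 0 + face₁₂ A i j n)
      + ∑ i ∈ range (2 * n), ∑ j ∈ range n, (face₁₂ B i j 0 + face₁₂ B i j n) = 0 := by
    have f₁ := flip (C := A) (D := A) (s := 0) (Nat.zero_le n) hA (by simpa using glueA)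
    have f₂ := flip (C := B) (D := B) (s := 0) (Nat.zero_le n) hB (by simpa using glueB)
    have f₃ := flip (C := A) (D := B) (s := n) le_rfl hB glueA'
    have f₄ := flip (C := B) (D := A) (s := n) le_rfl hA glueB'
    simp only [zero_add] at f₁ f₂
    simp only [sum_add_distrib, sum_range_two_mul, f₁, f₂, f₃, f₄]
    ring_nf
    rw [two]; ring
  -- each box ends where the other begins
  have ends : ∑ j ∈ range n, ∑ k ∈ range n, (face₂₃ A 0 j k + face₂₃ A (2 * n) j k)
      + ∑ j ∈ range n, ∑ k ∈ range n, (face₂₃ B 0 j k + face₂₃ B (2 * n) j k) = 0 := by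
    have f₁ : ∀ j k, face₂₃ A (2 * n) j k = face₂₃ B 0 j k := fun j k => by
      simp only [face₂₃, endA]
    have f₂ : ∀ j k, face₂₃ B (2 * n) j k = face₂₃ A 0 j k := fun j k => by
      simp only [face₂₃, endB]
    simp only [f₁, f₂, sum_add_distrib]
    ring_nf
    rw [two]; ring
  -- the first halves of the outer faces agree, and the second halves carry no label `(1, false)`
  have outer : ∑ i ∈ range (2 * n), ∑ k ∈ range n, face₁₃ A i n k
      + ∑ i ∈ range (2 * n), ∑ k ∈ range n, face₁₃ B i n k = 0 := by
    have f₁ : ∑ i ∈ range n, ∑ k ∈ range n, face₁₃ B i n k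
        = ∑ i ∈ range n, ∑ k ∈ range n, face₁₃ A i n k := by
      refine sum_congr rfl fun i hi => sum_congr rfl fun k _ => ?_
      rw [mem_range] at hi
      simp only [face₁₃, side i _ hi.le, side (i + 1) _ hi]
    have f₂ : ∀ {C : ℕ → ℕ → ℕ → SignedAxis},
        (∀ i k, n ≤ i → i ≤ 2 * n → k ≤ n → C i n k ≠ (1, false)) →
        ∑ i ∈ range n, ∑ k ∈ range n, face₁₃ C (n + i) n k = 0 := by
      intro C h
      refine sum_eq_zero fun i hi => sum_eq_zero fun k hk => ?_
      rw [mem_range] at hi hk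
      unfold face₁₃ sq
      rw [c₂_eq_zero, c₂_eq_zero, add_zero] <;> apply h <;> omega
    rw [sum_range_two_mul, sum_range_two_mul, f₁, f₂ topA, f₂ topB]
    ring_nf
    rw [two]; ring
  have inn : ∑ i ∈ range (2 * n), ∑ k ∈ range n, face₁₃ A i 0 k
      + ∑ i ∈ range (2 * n), ∑ k ∈ range n, face₁₃ B i 0 k = 0 := by
    have hA' := sum_faces_box hA
    have hB' := sum_faces_box hB
    simp only [sum_add_distrib (f := fun k => face₁₃ _ _ 0 k),
      sum_add_distrib (f := fun i => ∑ k ∈ range n, face₁₃ _ i 0 k)] at hA' hB'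
    linear_combination hA' + hB' - tau - ends - outer
  -- on the inner faces, opposite squares have opposite labels, so `c₂ + ν c₂ = δ c₁` applies
  have h₁ : ∀ i ∈ range (2 * n), ∀ k ∈ range n, face₁₃ A i 0 k + face₁₃ B i 0 k
      = (c₁ (A i 0 k) (A (i + 1) 0 k) + c₁ (A i 0 (k + 1)) (A (i + 1) 0 (k + 1)))
        + (c₁ (A i 0 k) (A i 0 (k + 1)) + c₁ (A (i + 1) 0 k) (A (i + 1) 0 (k + 1))) := by
    intro i hi k hk
    rw [mem_range] at hi hk
    unfold face₁₃
    rw [inner i k hi.le hk.le, inner (i + 1) k hi hk.le, inner i (k + 1) hi.le hk,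
      inner (i + 1) (k + 1) hi hk]
    rw [sq_add_neg, ← add_assoc] <;> apply hA <;> omega
  have h₂ : ∑ i ∈ range (2 * n), (c₁ (A i 0 0) (A (i + 1) 0 0) + c₁ (A i 0 n) (A (i + 1) 0 n))
      + ∑ k ∈ range n, (c₁ (A 0 0 k) (A 0 0 (k + 1)) + c₁ (A (2 * n) 0 k) (A (2 * n) 0 (k + 1)))
      = 0 := by
    rw [← inn, ← sum_add_distrib]
    simp only [← sum_add_distrib]
    rw [sum_congr rfl fun i hi => sum_congr rfl fun k hk => h₁ i hi k hk]
    simp only [sum_add_distrib (f := fun k => c₁ (A _ 0 k) (A (_ + 1) 0 k)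
      + c₁ (A _ 0 (k + 1)) (A (_ + 1) 0 (k + 1)))]
    rw [sum_add_distrib (f := fun i => ∑ k ∈ range n, _)]
    congr 1
    · exact sum_congr rfl fun i _ =>
        (sum_range_add_succ (fun k => c₁ (A i 0 k) (A (i + 1) 0 k)) n).symm
    · rw [sum_comm]
      exact sum_congr rfl fun k _ =>
        (sum_range_add_succ (fun i => c₁ (A i 0 k) (A i 0 (k + 1))) (2 * n)).symm
  -- the edges in the last direction at the two ends are antipodal, so `c₁ + ν c₁ = δ c₀` applies
  have h₃ : ∑ k ∈ range n, (c₁ (A 0 0 k) (A 0 0 (k + 1)) + c₁ (A (2 * n) 0 k) (A (2 * n) 0 (k + 1)))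
      = c₀ (A 0 0 0) + c₀ (A n 0 0) := by
    have e : A 0 0 n = A n 0 0 := glueA 0 0 (Nat.zero_le n)
    rw [← e, ← sum_range_add_succ (fun k => c₀ (A 0 0 k)) n]
    refine sum_congr rfl fun k hk => ?_
    rw [mem_range] at hk
    rw [endA, endA, inner _ _ (Nat.zero_le _) hk.le, inner _ _ (Nat.zero_le _) hk]
    apply c₁_add_neg; apply hA <;> omega
  -- reflection maps one side of the square to itself and the other one to its antipode
  have h₄ : ∑ i ∈ range n, c₁ (A i 0 n) (A (i + 1) 0 n)
      = ∑ i ∈ range n, c₁ (A i 0 0) (A (i + 1) 0 0) := by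
    rw [← sum_range_reflect (fun i => c₁ (A i 0 0) (A (i + 1) 0 0))]
    refine sum_congr rfl fun i hi => ?_
    rw [mem_range] at hi
    rw [glueA i 0 hi.le, glueA (i + 1) 0 hi, c₁_comm, show n - i = n - 1 - i + 1 by omega,
      show n - (i + 1) = n - 1 - i by omega]
  have h₅ : ∑ i ∈ range n, c₁ (A (n + i) 0 n) (A (n + i + 1) 0 n)
      = ∑ i ∈ range n, c₁ (A (n + i) 0 0).neg (A (n + i + 1) 0 0).neg := by
    rw [← sum_range_reflect (fun i => c₁ (A (n + i) 0 0).neg (A (n + i + 1) 0 0).neg)]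
    refine sum_congr rfl fun i hi => ?_
    rw [mem_range] at hi
    rw [add_assoc n i 1, glueA' i 0 hi.le, glueA' (i + 1) 0 hi, inner _ 0 (by omega) (Nat.zero_le n),
      inner _ 0 (by omega) (Nat.zero_le n), c₁_comm,
      show n - i = n - 1 - i + 1 by omega, show n - (i + 1) = n - 1 - i by omega, ← add_assoc]
  have h₆ : ∑ i ∈ range n, (c₁ (A (n + i) 0 0) (A (n + i + 1) 0 0)
      + c₁ (A (n + i) 0 0).neg (A (n + i + 1) 0 0).neg) = c₀ (A n 0 0) + c₀ (A (2 * n) 0 0) := by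
    refine Eq.trans ?_ ((sum_range_add_succ (fun i => c₀ (A (n + i) 0 0)) n).trans
      (by rw [add_zero, two_mul]))
    refine sum_congr rfl fun i hi => ?_
    rw [mem_range] at hi
    apply c₁_add_neg; apply hA <;> omega
  have h₇ : c₀ (A 0 0 0) + c₀ (A (2 * n) 0 0) = 1 := by
    rw [endA, inner 0 0 (Nat.zero_le _) (Nat.zero_le _), c₀_neg]
  rw [sum_add_distrib, sum_range_two_mul, sum_range_two_mul, h₃, h₄, h₅] at h₂
  rw [sum_add_distrib] at h₆
  have : (1 : ZMod 2) = 0 := by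
    linear_combination h₂ - h₆ - h₇
      - (∑ i ∈ range n, c₁ (A i 0 0) (A (i + 1) 0 0) + c₀ (A n 0 0)) * two
  exact absurd this (by decide)


/-! ### A Borsuk–Ulam theorem for a family of loops -/

/-- The half-axis nearest to `x`: the first coordinate of largest modulus, with its sign. For `x =
0` the value has no meaning. -/
noncomputable def ofVec (x : Fin 3 → ℝ) : SignedAxis :=
  let i : Fin 3 := if |x 0| = ‖x‖ then 0 else if |x 1| = ‖x‖ then 1 else 2
  (i, decide (0 < x i))

theorem abs_ofVec (x : Fin 3 → ℝ) : |x (ofVec x).1| = ‖x‖ := by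
  obtain ⟨i, hi⟩ : ∃ i, |x i| = ‖x‖ := by
    obtain ⟨i, hi⟩ := Finite.exists_max fun i => |x i|
    exact ⟨i, le_antisymm (norm_le_pi_norm x i) ((pi_norm_le_iff_of_nonneg (abs_nonneg _)).2 hi)⟩
  unfold ofVec
  dsimp only
  split_ifs with h₀ h₁
  · exact h₀
  · exact h₁
  · fin_cases i
    · exact absurd hi h₀
    · exact absurd hi h₁
    · exact hi

theorem ofVec_neg {x : Fin 3 → ℝ} (hx : x ≠ 0) : ofVec (-x) = (ofVec x).neg := by
  have h₁ : (ofVec (-x)).1 = (ofVec x).1 := by simp [ofVec]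
  have h : x (ofVec x).1 ≠ 0 := by
    rw [← abs_pos, abs_ofVec]; exact norm_pos_iff.2 hx
  refine Prod.ext h₁ ?_
  change decide (0 < (-x) (ofVec (-x)).1) = !decide (0 < x (ofVec x).1)
  rw [h₁, Pi.neg_apply, ← decide_not]
  refine decide_eq_decide.2 ?_
  rw [Left.neg_pos_iff, not_lt]
  exact ⟨le_of_lt, fun h' => lt_of_le_of_ne h' h⟩

theorem ofVec_ne {x : Fin 3 → ℝ} (hx : 0 < x 1) : ofVec x ≠ (1, false) := by
  intro h
  have h₁ : (ofVec x).1 = 1 := by rw [h]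
  have h₂ : decide (0 < x (ofVec x).1) = false := by
    change (ofVec x).2 = false
    rw [h]
  rw [h₁] at h₂
  exact of_decide_eq_false h₂ hx

theorem compat_ofVec {x y : Fin 3 → ℝ} (h : dist x y < ‖x‖) : Compat (ofVec x) (ofVec y) := by
  intro he
  have hx := abs_ofVec x
  have hd : |x (ofVec x).1 - y (ofVec x).1| ≤ dist x y := dist_le_pi_dist x y _
  change decide (0 < x (ofVec x).1) = decide (0 < y (ofVec y).1)
  rw [← he]
  refine decide_eq_decide.2 ?_
  rw [← hx] at h
  have := hd.trans_lt h
  constructor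
  · intro h0
    rw [abs_of_pos h0, abs_lt] at this
    linarith
  · intro h0
    by_contra hn
    rw [abs_of_nonpos (not_lt.1 hn), abs_lt] at this
    linarith

/-- A continuous map without zeros labels every fine enough grid compatibly. -/
theorem eventually_compatOn {H : ℝ → ℝ → ℝ → Fin 3 → ℝ}
    (hc : Continuous fun v : ℝ × ℝ × ℝ => H v.1 v.2.1 v.2.2)
    (h0 : ∀ t ∈ Set.Icc (0 : ℝ) 4, ∀ ρ ∈ Set.Icc (0 : ℝ) 1, ∀ τ ∈ Set.Icc (0 : ℝ) 1, H t ρ τ ≠ 0) :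
    ∃ n₀ : ℕ, 0 < n₀ ∧ ∀ n ≥ n₀,
      CompatOn (fun i j k => ofVec (H (2 * i / n) (j / n) (k / n))) (2 * n) n n := by
  set K : Set (ℝ × ℝ × ℝ) := Set.Icc 0 4 ×ˢ Set.Icc 0 1 ×ˢ Set.Icc 0 1 with hK
  have Kc : IsCompact K := isCompact_Icc.prod (isCompact_Icc.prod isCompact_Icc)
  have Kn : K.Nonempty := ⟨(0, 0, 0), by simp [hK]⟩
  obtain ⟨v, hv, hmin⟩ := Kc.exists_isMinOn Kn hc.norm.continuousOn
  have hpos : 0 < ‖H v.1 v.2.1 v.2.2‖ := norm_pos_iff.2 (h0 _ hv.1 _ hv.2.1 _ hv.2.2)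
  obtain ⟨δ, hδ, hunif⟩ := Metric.uniformContinuousOn_iff.1
    (Kc.uniformContinuousOn_of_continuous hc.continuousOn) _ hpos
  obtain ⟨n₀, hn₀⟩ := exists_nat_gt (2 / δ)
  refine ⟨n₀ + 1, Nat.succ_pos _, fun n hn => ?_⟩
  have hn' : (0 : ℝ) < n := by exact_mod_cast (by omega : 0 < n)
  have hlt : 2 / (n : ℝ) < δ := by
    rw [div_lt_iff₀ hn']
    rw [div_lt_iff₀ hδ] at hn₀
    have : (n₀ : ℝ) ≤ n := by exact_mod_cast (by omega : n₀ ≤ n)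
    nlinarith
  intro i i' j j' k k' hi hi' hj hj' hk hk' h₁ h₂ h₃ h₄ h₅ h₆
  have mem : ∀ i j k : ℕ, i ≤ 2 * n → j ≤ n → k ≤ n →
      ((2 * i / n, j / n, k / n) : ℝ × ℝ × ℝ) ∈ K := by
    intro i j k hi hj hk
    have hi : (i : ℝ) ≤ 2 * n := by exact_mod_cast hi
    have hj : (j : ℝ) ≤ n := by exact_mod_cast hj
    have hk : (k : ℝ) ≤ n := by exact_mod_cast hk
    refine ⟨⟨by positivity, ?_⟩, ⟨by positivity, ?_⟩, ⟨by positivity, ?_⟩⟩ <;>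
      · dsimp only
        rw [div_le_iff₀ hn']
        linarith
  have near : ∀ {a b : ℕ}, a ≤ b + 1 → b ≤ a + 1 → |(a : ℝ) - b| ≤ 1 := by
    intro a b h h'
    have h : (a : ℝ) ≤ b + 1 := by exact_mod_cast h
    have h' : (b : ℝ) ≤ a + 1 := by exact_mod_cast h'
    rw [abs_le]
    constructor <;> linarith
  have near' : ∀ {a b : ℕ}, a ≤ b + 1 → b ≤ a + 1 → dist ((a : ℝ) / n) (b / n) < δ := by
    intro a b h h'
    rw [Real.dist_eq, ← sub_div, abs_div, abs_of_pos hn']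
    refine lt_of_le_of_lt ?_ hlt
    gcongr
    linarith [near h h']
  refine compat_ofVec (lt_of_lt_of_le
    (hunif _ (mem i j k hi hj hk) _ (mem i' j' k' hi' hj' hk') ?_) (hmin (mem i j k hi hj hk)))
  rw [Prod.dist_eq, Prod.dist_eq]
  refine max_lt ?_ (max_lt (near' h₃ h₄) (near' h₅ h₆))
  dsimp only
  rw [Real.dist_eq, ← sub_div, ← mul_sub, abs_div, abs_of_pos hn', abs_mul, abs_two]
  refine lt_of_le_of_lt ?_ hlt
  gcongr
  linarith [near h₁ h₂]

end SignedAxis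

open SignedAxis in
/-- Let `(p, q)` run through the boundary of the square `[-1, 1]²`, and `ρ`, `τ` through `[0, 1]`. A
continuous map `G` into `ℝ³` has a zero if it is odd in `(p, q)` on the inner boundary `ρ = 0`, if
the slice `τ = 1` is the slice `τ = 0` reflected in `q`, and if on the outer boundary `ρ = 1` the
vertical sides are identified by the antipodal map while the horizontal sides go to an open
half-space. The parameter space is `S¹ × M` for a Möbius strip `M`, minus a neighbourhood of the
graph of a one-sided loop; the reflection records that the loop is one-sided. -/
theorem exists_zero_of_equivariant {G : ℝ → ℝ → ℝ → ℝ → Fin 3 → ℝ}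
    (hc : Continuous fun v : ℝ × ℝ × ℝ × ℝ => G v.1 v.2.1 v.2.2.1 v.2.2.2)
    (inner : ∀ p q τ, G (-p) (-q) 0 τ = -G p q 0 τ)
    (glue : ∀ p q ρ, G p q ρ 1 = G p (-q) ρ 0)
    (side : ∀ q τ, G (-1) (-q) 1 τ = G 1 q 1 τ)
    (top : ∀ p q, |q| = 1 → ∀ τ ∈ Set.Icc (0 : ℝ) 1, 0 < G p q 1 τ 1) :
    ∃ p q, max |p| |q| = 1 ∧ ∃ ρ ∈ Set.Icc (0 : ℝ) 1, ∃ τ ∈ Set.Icc (0 : ℝ) 1, G p q ρ τ = 0 := by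
  by_contra! h
  -- `(P, Q)` traverses the sides `p = 1` and `q = 1` of the square as `t` goes from `0` to `4`
  set P : ℝ → ℝ := fun t => min 1 (3 - t) with hP
  set Q : ℝ → ℝ := fun t => min 1 (t - 1) with hQ
  have hP₁ : ∀ t ≤ 2, P t = 1 := fun t ht => min_eq_left (by linarith)
  have hP₂ : ∀ t, 2 ≤ t → P t = 3 - t := fun t ht => min_eq_right (by linarith)
  have hQ₁ : ∀ t ≤ 2, Q t = t - 1 := fun t ht => min_eq_right (by linarith)
  have hQ₂ : ∀ t, 2 ≤ t → Q t = 1 := fun t ht => min_eq_left (by linarith)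
  have hmax : ∀ t ∈ Set.Icc (0 : ℝ) 4, max |P t| |Q t| = 1 := by
    rintro t ⟨h0, h4⟩
    rcases le_total t 2 with ht | ht
    · rw [hP₁ t ht, hQ₁ t ht, abs_one]
      exact max_eq_left (abs_le.2 ⟨by linarith, by linarith⟩)
    · rw [hP₂ t ht, hQ₂ t ht, abs_one]
      exact max_eq_right (abs_le.2 ⟨by linarith, by linarith⟩)
  have hA0 : ∀ t ∈ Set.Icc (0 : ℝ) 4, ∀ ρ ∈ Set.Icc (0 : ℝ) 1, ∀ τ ∈ Set.Icc (0 : ℝ) 1,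
      G (P t) (Q t) ρ τ ≠ 0 := fun t ht => h _ _ (hmax t ht)
  have hB0 : ∀ t ∈ Set.Icc (0 : ℝ) 4, ∀ ρ ∈ Set.Icc (0 : ℝ) 1, ∀ τ ∈ Set.Icc (0 : ℝ) 1,
      G (-P t) (-Q t) ρ τ ≠ 0 := fun t ht => h _ _ (by rw [abs_neg, abs_neg]; exact hmax t ht)
  obtain ⟨n₁, hn₁, hA⟩ := eventually_compatOn (H := fun t ρ τ => G (P t) (Q t) ρ τ)
    (hc.comp (by fun_prop : Continuous fun v : ℝ × ℝ × ℝ => (P v.1, Q v.1, v.2.1, v.2.2))) hA0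
  obtain ⟨n₂, hn₂, hB⟩ := eventually_compatOn (H := fun t ρ τ => G (-P t) (-Q t) ρ τ)
    (hc.comp (by fun_prop : Continuous fun v : ℝ × ℝ × ℝ => (-P v.1, -Q v.1, v.2.1, v.2.2))) hB0
  obtain ⟨n, hnA, hnB⟩ : ∃ n, n₁ ≤ n ∧ n₂ ≤ n := ⟨max n₁ n₂, le_max_left _ _, le_max_right _ _⟩
  have hn : (0 : ℝ) < n := by exact_mod_cast hn₁.trans_le hnA
  have nn : (n : ℝ) / n = 1 := div_self hn.ne'
  have low : ∀ i : ℕ, i ≤ n → (2 * i / n : ℝ) ≤ 2 := by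
    intro i hi
    have hi : (i : ℝ) ≤ n := by exact_mod_cast hi
    rw [div_le_iff₀ hn]; linarith
  have high : ∀ i : ℕ, n ≤ i → (2 : ℝ) ≤ 2 * i / n := by
    intro i hi
    have hi : (n : ℝ) ≤ i := by exact_mod_cast hi
    rw [le_div_iff₀ hn]; linarith
  have end₂ : ((2 * (2 * n : ℕ) / n : ℝ)) = 4 := by
    push_cast; field_simp; norm_num
  have start : (2 * (0 : ℕ) / n : ℝ) = 0 := by simp
  -- reflecting the vertical coordinate reverses the side `p = 1`
  have refl₁ : ∀ i : ℕ, i ≤ n → P (2 * i / n) = P (2 * (n - i : ℕ) / n)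
      ∧ -Q (2 * i / n) = Q (2 * (n - i : ℕ) / n) := by
    intro i hi
    rw [hP₁ _ (low i hi), hP₁ _ (low _ (Nat.sub_le n i)), hQ₁ _ (low i hi),
      hQ₁ _ (low _ (Nat.sub_le n i)), Nat.cast_sub hi]
    refine ⟨rfl, ?_⟩
    field_simp; ring
  -- and takes the side `q = 1` to its antipode `q = -1`
  have refl₂ : ∀ i : ℕ, i ≤ n → P (2 * (n + i : ℕ) / n) = -P (2 * (n + (n - i) : ℕ) / n)
      ∧ Q (2 * (n + i : ℕ) / n) = Q (2 * (n + (n - i) : ℕ) / n) := by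
    intro i hi
    rw [hP₂ _ (high _ (Nat.le_add_right n i)), hP₂ _ (high _ (Nat.le_add_right n _)),
      hQ₂ _ (high _ (Nat.le_add_right n i)), hQ₂ _ (high _ (Nat.le_add_right n _)),
      Nat.cast_add, Nat.cast_add, Nat.cast_sub hi]
    refine ⟨?_, rfl⟩
    field_simp; ring
  have unit : ∀ k : ℕ, k ≤ n → (k / n : ℝ) ∈ Set.Icc (0 : ℝ) 1 := by
    intro k hk
    have hk : (k : ℝ) ≤ n := by exact_mod_cast hk
    exact ⟨by positivity, (div_le_one hn).2 hk⟩
  have ends : P 4 = -P 0 ∧ Q 4 = -Q 0 := by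
    rw [hP₂ _ (by norm_num), hP₁ _ (by norm_num), hQ₂ _ (by norm_num), hQ₁ _ (by norm_num)]
    norm_num
  refine not_exists_labels (hA n hnA) (hB n hnB) ?_ ?_ ?_ ?_ ?_ ?_ ?_ ?_ ?_ ?_
  · intro j k
    rw [end₂, start, ends.1, ends.2]
  · intro j k
    rw [end₂, start, ends.1, ends.2, neg_neg, neg_neg]
  · intro i k hi hk
    rw [Nat.cast_zero, zero_div, inner, ofVec_neg]
    have hi : (i : ℝ) ≤ 2 * n := by exact_mod_cast hi
    refine hA0 _ ⟨by positivity, ?_⟩ _ (by simp) _ (unit k hk)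
    rw [div_le_iff₀ hn]; linarith
  · intro i k hi
    rw [nn, hP₁ _ (low i hi), side]
  · intro i k hi _ hk
    rw [nn]
    exact ofVec_ne (top _ _ (by rw [hQ₂ _ (high i hi), abs_one]) _ (unit k hk))
  · intro i k hi _ hk
    rw [nn]
    exact ofVec_ne (top _ _ (by rw [hQ₂ _ (high i hi), abs_neg, abs_one]) _ (unit k hk))
  · intro i j hi
    rw [nn, Nat.cast_zero, zero_div, glue, (refl₁ i hi).1, (refl₁ i hi).2]
  · intro i j hi
    rw [nn, Nat.cast_zero, zero_div, glue, (refl₁ i hi).1, (refl₁ i hi).2]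
  · intro i j hi
    rw [nn, Nat.cast_zero, zero_div, glue, (refl₂ i hi).1, (refl₂ i hi).2]
  · intro i j hi
    rw [nn, Nat.cast_zero, zero_div, glue, (refl₂ i hi).1, (refl₂ i hi).2, neg_neg, neg_neg]

/-! ### The space of chords of a loop -/

/-- Vaughan's map on the chords of a loop `g` of period `1`. The chord from `g u` to `g v` has the
coordinates `m = u + v` and `d = v - u`; the map gives twice its midpoint and, as the middle
coordinate, the square of its length. The Möbius strip of chords is the strip `0 ≤ d ≤ 1` modulo the
glide reflection `(m, d) ↦ (m + 1, 1 - d)`, which exchanges the two ends of a chord. -/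
noncomputable def chordMap (g : ℝ → Plane) (m d : ℝ) : Fin 3 → ℝ :=
  ![(g ((m - d) / 2) + g ((m + d) / 2)) 0, ‖g ((m - d) / 2) - g ((m + d) / 2)‖ ^ 2,
    (g ((m - d) / 2) + g ((m + d) / 2)) 1]

theorem chordMap_apply_one (g : ℝ → Plane) (m d : ℝ) :
    chordMap g m d 1 = ‖g ((m - d) / 2) - g ((m + d) / 2)‖ ^ 2 := rfl

theorem chordMap_glide {g : ℝ → Plane} (hg : Function.Periodic g 1) (m d : ℝ) :
    chordMap g (m + 1) (1 - d) = chordMap g m d := by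
  have h₁ : (m + 1 - (1 - d)) / 2 = (m + d) / 2 := by ring
  have h₂ : (m + 1 + (1 - d)) / 2 = (m - d) / 2 + 1 := by ring
  simp only [chordMap, h₁, h₂, hg _, add_comm (g ((m + d) / 2)), norm_sub_rev (g ((m + d) / 2))]

theorem continuous_chordMap {g : ℝ → Plane} (hg : Continuous g) :
    Continuous fun v : ℝ × ℝ => chordMap g v.1 v.2 := by
  have h₁ : Continuous fun v : ℝ × ℝ => g ((v.1 - v.2) / 2) := hg.comp (by fun_prop)
  have h₂ : Continuous fun v : ℝ × ℝ => g ((v.1 + v.2) / 2) := hg.comp (by fun_prop)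
  refine continuous_pi fun i => ?_
  fin_cases i
  · exact (EuclideanSpace.proj (𝕜 := ℝ) (0 : Fin 2)).continuous.comp (h₁.add h₂)
  · exact (h₁.sub h₂).norm.pow 2
  · exact (EuclideanSpace.proj (𝕜 := ℝ) (1 : Fin 2)).continuous.comp (h₁.add h₂)

/-- Two segments with the same midpoint and the same length are the diagonals of a rectangle. -/
theorem isNondegenerateRectangle_of_diagonals {A B C D : Plane} (hs : A + C = B + D)
    (hn : ‖A - C‖ ^ 2 = ‖B - D‖ ^ 2) (hB : A ≠ B) (hD : A ≠ D) :
    IsNondegenerateRectangle A B C D := by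
  have hD' : D = A + C - B := by rw [hs]; abel
  refine ⟨by rw [hD']; abel, ?_, hB, hD⟩
  have e₁ : A - C = -((B - A) + (D - A)) := by rw [hD']; abel
  have e₂ : B - D = (B - A) - (D - A) := by abel
  rw [e₁, e₂, norm_neg, norm_add_sq_real (B - A), norm_sub_sq_real (B - A) (D - A)] at hn
  linarith

/-- If no non-degenerate rectangle has a vertex at one end of a chord, then the chord is determined
by its midpoint and length. The bound on `m' - m` excludes the translates under the glide
reflection. -/
theorem chordMap_injOn {g : ℝ → Plane} (hg : ∀ x y, g x = g y → ∃ k : ℤ, y = x + k)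
    {m d m' d' : ℝ} (hd : d ∈ Set.Icc (0 : ℝ) 1) (hd' : d' ∈ Set.Icc (0 : ℝ) 1)
    (hm : |m' - m| < 1)
    (hrect : ∀ b c e : ℝ, ¬ IsNondegenerateRectangle (g ((m - d) / 2)) (g b) (g c) (g e))
    (h : chordMap g m d = chordMap g m' d') : m = m' ∧ d = d' := by
  have hs : g ((m - d) / 2) + g ((m + d) / 2) = g ((m' - d') / 2) + g ((m' + d') / 2) := by
    ext i
    fin_cases i
    · exact congrFun h 0
    · exact congrFun h 2
  have hn : ‖g ((m - d) / 2) - g ((m + d) / 2)‖ ^ 2 = ‖g ((m' - d') / 2) - g ((m' + d') / 2)‖ ^ 2 :=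
    congrFun h 1
  obtain ⟨h0, h1⟩ := hd
  obtain ⟨h0', h1'⟩ := hd'
  rw [abs_lt] at hm
  have int_eq_zero : ∀ {k : ℤ}, -1 < (k : ℝ) → (k : ℝ) < 1 → k = 0 := fun h₁ h₂ =>
    Int.abs_lt_one_iff.1 (by exact_mod_cast abs_lt.2 ⟨h₁, h₂⟩)
  have cases : g ((m - d) / 2) = g ((m' - d') / 2) ∨ g ((m - d) / 2) = g ((m' + d') / 2) := by
    by_contra! hne
    exact hrect _ _ _ (isNondegenerateRectangle_of_diagonals hs hn hne.1 hne.2)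
  rcases cases with he | he
  · have he' : g ((m + d) / 2) = g ((m' + d') / 2) := by rwa [he, add_right_inj] at hs
    obtain ⟨k, hk⟩ := hg _ _ he
    obtain ⟨l, hl⟩ := hg _ _ he'
    -- `m' - m = k + l` is of modulus less than `1`, so `k = -l`; then `d' - d = 2 * l`
    have hkl : k + l = 0 := int_eq_zero (by push_cast; linarith) (by push_cast; linarith)
    have hkl' : (k : ℝ) + l = 0 := by exact_mod_cast hkl
    have hl0 : (l : ℝ) = 0 := by exact_mod_cast int_eq_zero (k := l) (by linarith) (by linarith)
    constructor <;> linarith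
  · have he' : g ((m + d) / 2) = g ((m' - d') / 2) := by
      rwa [he, add_comm, add_left_inj] at hs
    obtain ⟨k, hk⟩ := hg _ _ he
    obtain ⟨l, hl⟩ := hg _ _ he'
    have hkl : k + l = 0 := int_eq_zero (by push_cast; linarith) (by push_cast; linarith)
    have hkl' : (k : ℝ) + l = 0 := by exact_mod_cast hkl
    -- `d + d' = 2 * k` with `d` and `d'` in `[0, 1]`, so both are `0` or both are `1`
    have hk₂ : -1 < k ∧ k < 2 := by
      have h₁ : (-1 : ℝ) < k := by linarith
      have h₂ : (k : ℝ) < 2 := by linarith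
      exact ⟨by exact_mod_cast h₁, by exact_mod_cast h₂⟩
    obtain rfl | rfl : k = 0 ∨ k = 1 := by omega
    all_goals
      push_cast at hk hkl'
      constructor <;> linarith

/-! ### Rectangles with a vertex on a given arc -/

/-- The one-sided loop of chords is `τ ↦ (m₀ τ, d₀ τ)`: the first end of the chord moves slightly
from `x₀` to `x₀ + r`, while the second runs from `x₀ + r` around the curve to `x₀ + 1`. The two
chords compared by `G` are displaced from this one in the direction `-(p, q)` and `(p, q)`. For `ρ =
0` the displacements are opposite; for `ρ = 1` the first vanishes, and the second reaches the
boundary of the fundamental domain `|m - m₀ τ| ≤ 1 / 2`, `0 ≤ d ≤ 1` of the strip. -/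
theorem exists_rectangle_near {g : ℝ → Plane} (hc : Continuous g) (hp : Function.Periodic g 1)
    (hg : ∀ x y, g x = g y → ∃ k : ℤ, y = x + k) (x₀ : ℝ) {η : ℝ} (hη : 0 < η) :
    ∃ a ∈ Metric.ball x₀ η, ∃ b c e : ℝ, IsNondegenerateRectangle (g a) (g b) (g c) (g e) := by
  by_contra! hno
  obtain ⟨r, hr, hrη, hr4⟩ : ∃ r : ℝ, 0 < r ∧ 2 * r < η ∧ r < 1 / 4 :=
    ⟨min (η / 4) (1 / 8), by positivity, by linarith [min_le_left (η / 4) (1 / 8)],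
      by linarith [min_le_right (η / 4) (1 / 8)]⟩
  set m₀ : ℝ → ℝ := fun τ => 2 * x₀ + r + τ with hm₀
  set d₀ : ℝ → ℝ := fun τ => r + (1 - 2 * r) * τ with hd₀
  have hd₀mem : ∀ τ ∈ Set.Icc (0 : ℝ) 1, r ≤ d₀ τ ∧ d₀ τ ≤ 1 - r := by
    rintro τ ⟨h0, h1⟩
    constructor <;> simp only [hd₀] <;> nlinarith
  have hm₁ : m₀ 1 = m₀ 0 + 1 := by simp only [hm₀]; ring
  have hd₁ : d₀ 1 = 1 - d₀ 0 := by simp only [hd₀]; ring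
  set X : ℝ → ℝ → ℝ → ℝ → Fin 3 → ℝ := fun p q ρ τ =>
    chordMap g (m₀ τ - (1 - ρ) * (r * p)) (d₀ τ - (1 - ρ) * (r * q)) with hX
  set Y : ℝ → ℝ → ℝ → ℝ → Fin 3 → ℝ := fun p q ρ τ =>
    chordMap g (m₀ τ + (1 - ρ) * (r * p) + ρ * (p / 2))
      ((1 - ρ) * (d₀ τ + r * q) + ρ * ((1 + q) / 2)) with hY
  obtain ⟨p, q, hpq, ρ, hρ, τ, hτ, hzero⟩ : ∃ p q, max |p| |q| = 1 ∧
      ∃ ρ ∈ Set.Icc (0 : ℝ) 1, ∃ τ ∈ Set.Icc (0 : ℝ) 1, X p q ρ τ - Y p q ρ τ = 0 := by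
    refine exists_zero_of_equivariant (G := fun p q ρ τ => X p q ρ τ - Y p q ρ τ) ?_ ?_ ?_ ?_ ?_
    · have := continuous_chordMap hc
      refine Continuous.sub (this.comp (by fun_prop : Continuous fun v : ℝ × ℝ × ℝ × ℝ =>
        (m₀ v.2.2.2 - (1 - v.2.2.1) * (r * v.1), d₀ v.2.2.2 - (1 - v.2.2.1) * (r * v.2.1))))
        (this.comp (by fun_prop : Continuous fun v : ℝ × ℝ × ℝ × ℝ =>
        (m₀ v.2.2.2 + (1 - v.2.2.1) * (r * v.1) + v.2.2.1 * (v.1 / 2),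
          (1 - v.2.2.1) * (d₀ v.2.2.2 + r * v.2.1) + v.2.2.1 * ((1 + v.2.1) / 2))))
    · intro p q τ
      simp only [hX, hY]
      rw [neg_sub]
      congr 2 <;> ring
    · intro p q ρ
      simp only [hX, hY]
      rw [← chordMap_glide hp (m₀ 0 - _), ← chordMap_glide hp (m₀ 0 + _ + _), hm₁, hd₁]
      congr 2 <;> ring
    · intro q τ
      simp only [hX, hY]
      rw [← chordMap_glide hp (m₀ τ + (1 - 1) * (r * -1) + _)]
      congr 2 <;> ring
    · intro p q hq τ hτ
      obtain ⟨hd0, hd1⟩ := hd₀mem τ hτ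
      have hY0 : Y p q 1 τ 1 = 0 := by
        have e : (1 - 1) * (d₀ τ + r * q) + 1 * ((1 + q) / 2) = (1 + q) / 2 := by ring
        simp only [hY, e]
        rcases (abs_eq zero_le_one).1 hq with rfl | rfl
        · rw [show ((1 : ℝ) + 1) / 2 = 1 - 0 by norm_num, chordMap_apply_one,
            ← hp ((_ - (1 - 0)) / 2)]
          refine pow_eq_zero_iff two_ne_zero |>.2 (norm_sub_eq_zero_iff.2 (congrArg g ?_))
          ring
        · rw [chordMap_apply_one]
          refine pow_eq_zero_iff two_ne_zero |>.2 (norm_sub_eq_zero_iff.2 (congrArg g ?_))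
          ring
      have hX0 : 0 < X p q 1 τ 1 := by
        simp only [hX]
        rw [chordMap_apply_one]
        refine pow_pos (norm_sub_pos_iff.2 fun he => ?_) 2
        obtain ⟨k, hk⟩ := hg _ _ he
        have hk' : (k : ℝ) = d₀ τ := by linarith
        have a : (0 : ℤ) < k := by
          have : (0 : ℝ) < k := by linarith
          exact_mod_cast this
        have b : k < (1 : ℤ) := by
          have : (k : ℝ) < 1 := by linarith
          exact_mod_cast this
        omega
      rw [Pi.sub_apply, hY0, sub_zero]
      exact hX0
  have hp1 : |p| ≤ 1 := hpq ▸ le_max_left _ _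
  have hq1 : |q| ≤ 1 := hpq ▸ le_max_right _ _
  obtain ⟨h0, h1⟩ := hρ
  obtain ⟨hd0, hd1⟩ := hd₀mem τ hτ
  have s0 : 0 ≤ 1 - ρ := by linarith
  have scaled : ∀ {x : ℝ}, |x| ≤ 1 → |r * x| ≤ r := fun hx => by
    rw [abs_mul, abs_of_pos hr]
    exact mul_le_of_le_one_right hr.le hx
  have scaled' : ∀ {x : ℝ}, |x| ≤ 1 → |(1 - ρ) * (r * x)| ≤ r := fun hx => by
    rw [abs_mul, abs_of_nonneg s0]
    exact (mul_le_of_le_one_left (abs_nonneg _) (by linarith)).trans (scaled hx)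
  have hrq := abs_le.1 (scaled hq1)
  have ha := abs_le.1 (scaled' hp1)
  have hb := abs_le.1 (scaled' hq1)
  rw [abs_le] at hp1 hq1
  have key := chordMap_injOn hg (m := m₀ τ - (1 - ρ) * (r * p)) (d := d₀ τ - (1 - ρ) * (r * q))
    (m' := m₀ τ + (1 - ρ) * (r * p) + ρ * (p / 2))
    (d' := (1 - ρ) * (d₀ τ + r * q) + ρ * ((1 + q) / 2)) ⟨by linarith, by linarith⟩
    ⟨by apply add_nonneg <;> apply mul_nonneg <;> linarith, by nlinarith⟩
    (by rw [abs_lt]; constructor <;> nlinarith) ?_ (sub_eq_zero.1 hzero)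
  · obtain ⟨k₁, k₂⟩ := key
    -- `k₁` says that a positive multiple of `p` vanishes; hence `q = ±1`, and `k₂` fails since
    -- both of its displacements from `d₀ τ` point in the direction of `q`
    have e₁ : (2 * (1 - ρ) * r + ρ / 2) * p = 0 := by linarith
    have pos : 0 < 2 * (1 - ρ) * r + ρ / 2 := by nlinarith
    have hp0 : p = 0 := (mul_eq_zero.1 e₁).resolve_left pos.ne'
    rw [hp0, abs_zero, max_eq_right (abs_nonneg q)] at hpq
    rcases (abs_eq zero_le_one).1 hpq with rfl | rfl <;> nlinarith
  · intro b c e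
    refine hno _ ?_ b c e
    rw [Metric.mem_ball, Real.dist_eq, abs_lt]
    obtain ⟨t0, t1⟩ := hτ
    have hrτ : 0 ≤ r * τ ∧ r * τ ≤ r := ⟨by positivity, mul_le_of_le_one_right hr.le t1⟩
    simp only [hm₀, hd₀]
    constructor <;> linarith

theorem exists_periodic_parametrization {γ : unitInterval → Plane} (hγ : IsSimpleLoop γ) :
    ∃ g : ℝ → Plane, Continuous g ∧ Function.Periodic g 1 ∧
      (∀ x y, g x = g y → ∃ k : ℤ, y = x + k) ∧ Set.range g = Set.range γ := by
  have fract_mem : ∀ x : ℝ, Int.fract x ∈ unitInterval := fun x =>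
    ⟨Int.fract_nonneg x, (Int.fract_lt_one x).le⟩
  set h : ℝ → Plane := Set.IccExtend zero_le_one γ with hh
  have h_of_mem : ∀ x (hx : x ∈ unitInterval), h x = γ ⟨x, hx⟩ := fun x hx =>
    Set.IccExtend_of_mem _ _ hx
  have h01 : h 0 = h 1 := by
    rw [h_of_mem 0 unitInterval.zero_mem, h_of_mem 1 unitInterval.one_mem]
    exact hγ.closed
  have hcont : Continuous h := hγ.continuous.Icc_extend'
  refine ⟨h ∘ Int.fract, hcont.continuousOn.comp_fract'' h01, ?_, ?_, ?_⟩
  · intro x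
    simp
  · intro x y hxy
    have inj : Int.fract x = Int.fract y := by
      simp only [Function.comp_apply, h_of_mem _ (fract_mem _)] at hxy
      by_contra hne
      rcases lt_or_gt_of_ne hne with hlt | hlt
      · have := (hγ.simple _ _ (Subtype.mk_lt_mk.2 hlt) hxy).2
        exact (Int.fract_lt_one y).ne (congrArg Subtype.val this)
      · have := (hγ.simple _ _ (Subtype.mk_lt_mk.2 hlt) hxy.symm).2
        exact (Int.fract_lt_one x).ne (congrArg Subtype.val this)
    refine ⟨⌊y⌋ - ⌊x⌋, ?_⟩
    push_cast
    linarith [Int.floor_add_fract x, Int.floor_add_fract y]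
  · refine Set.Subset.antisymm ?_ ?_
    · rintro _ ⟨x, rfl⟩
      exact ⟨⟨Int.fract x, fract_mem x⟩, (h_of_mem _ (fract_mem x)).symm⟩
    · rintro _ ⟨⟨s, hs⟩, rfl⟩
      rcases hs.2.lt_or_eq with hlt | rfl
      · refine ⟨s, ?_⟩
        rw [Function.comp_apply, Int.fract_eq_self.2 ⟨hs.1, hlt⟩, h_of_mem _ hs]
      · refine ⟨0, ?_⟩
        rw [Function.comp_apply, Int.fract_zero, h01, h_of_mem _ hs]

theorem theorem2p6 (γ : unitInterval → Plane) (hγ : IsSimpleLoop γ) :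
    Dense {p : Set.range γ | (p : Plane) ∈ inscribedRectangleVertices γ} := by
  obtain ⟨g, hc, hp, hg, hrange⟩ := exists_periodic_parametrization hγ
  have mem : ∀ x, g x ∈ Set.range γ := fun x => hrange ▸ Set.mem_range_self x
  rw [dense_iff_inter_open]
  rintro V hV ⟨⟨P, hP⟩, hPV⟩
  obtain ⟨x₀, rfl⟩ : P ∈ Set.range g := hrange ▸ hP
  have hopen : IsOpen ((fun x => (⟨g x, mem x⟩ : Set.range γ)) ⁻¹' V) :=
    hV.preimage (hc.subtype_mk mem)
  obtain ⟨η, hη, hball⟩ := Metric.isOpen_iff.1 hopen x₀ hPV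
  obtain ⟨a, ha, b, c, e, hr⟩ := exists_rectangle_near hc hp hg x₀ hη
  exact ⟨⟨g a, mem a⟩, hball ha, g a, g b, g c, g e, ⟨hr, mem a, mem b, mem c, mem e⟩, Or.inl rfl⟩
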